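/- A subproduct system is a family $X=(X_n)_{n\ge 0}$ of complex Hilbert spaces with $X_0=\mathbb C$ together with isometric inclusions $X_{m+n}\subseteq X_m\otimes X_n$ (Hilbert space tensor product) that are compatible with the canonical identifications $(X_l\otimes X_m)\otimes X_n=X_l\otimes(X_m\otimes X_n)$ and $\mathbb C\otimes X_n=X_n=X_n\otimes\mathbb C$. Let $p_{m+n}\colon X_m\otimes X_n\to X_{m+n}$ denote the orthogonal projection. On the Fock space $\mathcal F_X=\bigoplus_{n\ge 0}X_n$, each $x\in X_1$ defines the shift $S(x)\in B(\mathcal F_X)$ by $S(x)y=p_{n+1}(x\otimes y)$ for $y\in X_n$. The tensor algebra $\mathcal A_X\subseteq B(\mathcal F_X)$ is the norm closed unital algebra generated by $\{S(x):x\in X_1\}$. The vacuum state of $\mathcal A_X$ is the unital homomorphism $\Phi_0^X\colon\mathcal A_X\to\mathbb C$, $\Phi_0^X(T)=\langle T\Omega,\Omega\rangle$ with $\Omega=1\in\mathbb C=X_0\subseteq\mathcal F_X$ (equivalently, the degree-zero component of $T$). An algebra isomorphism $\varphi\colon\mathcal A_X\to\mathcal A_Y$ is called vacuum preserving if $\Phi_0^Y\circ\varphi=\Phi_0^X$.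 It is called a bounded isomorphism if $\varphi$ and $\varphi^{-1}$ are bounded, and a completely bounded isomorphism if $\varphi$ and $\varphi^{-1}$ are completely bounded. **Theorem.** Let $X$ and $Y$ be subproduct systems (with fibers of arbitrary dimension). 1. If there is an algebra isomorphism $\mathcal A_X\to\mathcal A_Y$, then there is a vacuum preserving algebra isomorphism $\mathcal A_X\to\mathcal A_Y$. 2. If there is a bounded isomorphism $\mathcal A_X\to\mathcal A_Y$, then there is a vacuum preserving bounded isomorphism $\mathcal A_X\to\mathcal A_Y$. 3. If there is an isometric isomorphism $\mathcal A_X\to\mathcal A_Y$, then there is a vacuum preserving isometric isomorphism $\mathcal A_X\to\mathcal A_Y$. 4. If there is a completely bounded isomorphism $\mathcal A_X\to\mathcal A_Y$, then there is a vacuum preserving completely bounded isomorphism $\mathcal A_X\to\mathcal A_Y$. -/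

import Mathlib

open scoped TensorProduct

noncomputable section

/-- The Hilbert space tensor product of two Hilbert spaces. -/
abbrev HilbertTensor (E F : Type*) [NormedAddCommGroup E] [InnerProductSpace ℂ E]
    [NormedAddCommGroup F] [InnerProductSpace ℂ F] : Type _ :=
  UniformSpace.Completion (E ⊗[ℂ] F)

/-- For an isometric inclusion `ι : G → E ⊗ F`, the image `p (x ⊗ y)` of an elementary tensor
under the orthogonal projection `p = ι*` of `E ⊗ F` onto `G`. -/
def HilbertTensor.proj {E F G : Type*} [NormedAddCommGroup E] [InnerProductSpace ℂ E]
    [NormedAddCommGroup F] [InnerProductSpace ℂ F]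
    [NormedAddCommGroup G] [InnerProductSpace ℂ G] [CompleteSpace G]
    (ι : G →ₗᵢ[ℂ] HilbertTensor E F) (x : E) (y : F) : G :=
  ContinuousLinearMap.adjoint ι.toContinuousLinearMap ((x ⊗ₜ[ℂ] y : E ⊗[ℂ] F) : HilbertTensor E F)

/-- A subproduct system (over `ℕ`, with Hilbert space fibers): Hilbert spaces `X n` with
`X 0 = ℂ` and `X k ⊆ X m ⊗ X n` whenever `m + n = k`. The inclusions are isometries `incl`;
they are compatible with the identifications `(X l ⊗ X m) ⊗ X n = X l ⊗ (X m ⊗ X n)` and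
`ℂ ⊗ X n = X n = X n ⊗ ℂ`, which is expressed through the adjoint projections. -/
structure SubproductSystem where
  fiber : ℕ → Type*
  [normed : ∀ n, NormedAddCommGroup (fiber n)]
  [innerProd : ∀ n, InnerProductSpace ℂ (fiber n)]
  [complete : ∀ n, CompleteSpace (fiber n)]
  zeroIso : fiber 0 ≃ₗᵢ[ℂ] ℂ
  incl : ∀ m n k : ℕ, m + n = k → (fiber k →ₗᵢ[ℂ] HilbertTensor (fiber m) (fiber n))
  assoc : ∀ (l m n lm mn k : ℕ) (h₁ : l + m = lm) (h₂ : lm + n = k) (h₃ : m + n = mn)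
    (h₄ : l + mn = k) (x : fiber l) (y : fiber m) (z : fiber n),
    HilbertTensor.proj (incl lm n k h₂) (HilbertTensor.proj (incl l m lm h₁) x y) z =
      HilbertTensor.proj (incl l mn k h₄) x (HilbertTensor.proj (incl m n mn h₃) y z)
  one_proj : ∀ (n : ℕ) (h : 0 + n = n) (x : fiber n),
    HilbertTensor.proj (incl 0 n n h) (zeroIso.symm 1) x = x
  proj_one : ∀ (n : ℕ) (h : n + 0 = n) (x : fiber n),
    HilbertTensor.proj (incl n 0 n h) x (zeroIso.symm 1) = x

attribute [instance] SubproductSystem.normed SubproductSystem.innerProd SubproductSystem.complete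

/-- Elementary bounds and additivity for `HilbertTensor.proj`. -/
theorem HilbertTensor.norm_proj_le {E F G : Type*} [NormedAddCommGroup E] [InnerProductSpace ℂ E]
    [NormedAddCommGroup F] [InnerProductSpace ℂ F]
    [NormedAddCommGroup G] [InnerProductSpace ℂ G] [CompleteSpace G]
    (ι : G →ₗᵢ[ℂ] HilbertTensor E F) (x : E) (y : F) :
    ‖HilbertTensor.proj ι x y‖ ≤ ‖x‖ * ‖y‖ := by
  refine (ContinuousLinearMap.le_opNorm _ _).trans ?_
  rw [UniformSpace.Completion.norm_coe, TensorProduct.norm_tmul]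
  refine mul_le_of_le_one_left (by positivity) ?_
  rw [LinearIsometryEquiv.norm_map]
  exact ι.norm_toContinuousLinearMap_le

theorem HilbertTensor.proj_add {E F G : Type*} [NormedAddCommGroup E] [InnerProductSpace ℂ E]
    [NormedAddCommGroup F] [InnerProductSpace ℂ F]
    [NormedAddCommGroup G] [InnerProductSpace ℂ G] [CompleteSpace G]
    (ι : G →ₗᵢ[ℂ] HilbertTensor E F) (x : E) (y z : F) :
    HilbertTensor.proj ι x (y + z) = HilbertTensor.proj ι x y + HilbertTensor.proj ι x z := by
  simp only [HilbertTensor.proj, TensorProduct.tmul_add, UniformSpace.Completion.coe_add, map_add]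

theorem HilbertTensor.proj_smul {E F G : Type*} [NormedAddCommGroup E] [InnerProductSpace ℂ E]
    [NormedAddCommGroup F] [InnerProductSpace ℂ F]
    [NormedAddCommGroup G] [InnerProductSpace ℂ G] [CompleteSpace G]
    (ι : G →ₗᵢ[ℂ] HilbertTensor E F) (x : E) (c : ℂ) (y : F) :
    HilbertTensor.proj ι x (c • y) = c • HilbertTensor.proj ι x y := by
  simp only [HilbertTensor.proj, TensorProduct.tmul_smul, UniformSpace.Completion.coe_smul,
    map_smul]

namespace SubproductSystem

/-- The `X`-Fock space, the Hilbert space direct sum of the fibers. -/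
abbrev Fock (X : SubproductSystem) : Type _ := lp X.fiber 2

/-- The components of `S(x) f`: degree `n + 1` holds `p (x ⊗ f n)`. -/
def shiftFun (X : SubproductSystem) (x : X.fiber 1) (f : X.Fock) : ∀ n, X.fiber n
  | 0 => 0
  | n + 1 => HilbertTensor.proj (X.incl 1 n (n + 1) (Nat.add_comm 1 n)) x (f n)

theorem hasSum_sq (X : SubproductSystem) (f : X.Fock) :
    HasSum (fun n => ‖f n‖ ^ 2) (‖f‖ ^ 2) := by
  simpa using lp.hasSum_norm (p := 2) (by norm_num) f

theorem norm_shiftFun_succ_le (X : SubproductSystem) (x : X.fiber 1) (f : X.Fock) (n : ℕ) :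
    ‖X.shiftFun x f (n + 1)‖ ^ 2 ≤ ‖x‖ ^ 2 * ‖f n‖ ^ 2 := by
  rw [← mul_pow]
  exact pow_le_pow_left₀ (norm_nonneg _) (HilbertTensor.norm_proj_le _ _ _) 2

theorem summable_shiftFun (X : SubproductSystem) (x : X.fiber 1) (f : X.Fock) :
    Summable fun n => ‖X.shiftFun x f n‖ ^ 2 := by
  rw [← summable_nat_add_iff 1]
  exact Summable.of_nonneg_of_le (fun n => by positivity) (X.norm_shiftFun_succ_le x f)
    ((X.hasSum_sq f).summable.mul_left _)

/-- The shift operator `S(x)`, `x ∈ X 1`, on the Fock space. -/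
def shift (X : SubproductSystem) (x : X.fiber 1) : X.Fock →L[ℂ] X.Fock :=
  LinearMap.mkContinuous
    { toFun := fun f => ⟨X.shiftFun x f, memℓp_gen (by simpa using X.summable_shiftFun x f)⟩
      map_add' := fun f g => by
        ext n
        cases n with
        | zero => exact (add_zero (0 : X.fiber 0)).symm
        | succ n => exact HilbertTensor.proj_add _ x (f n) (g n)
      map_smul' := fun c f => by
        ext n
        cases n with
        | zero => exact (smul_zero c).symm
        | succ n => exact HilbertTensor.proj_smul _ x c (f n) }
    ‖x‖ (fun f => by
      refine lp.norm_le_of_tsum_le (by norm_num) (by positivity) ?_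
      have h := X.summable_shiftFun x f
      have h2 := ((summable_nat_add_iff 1).2 h).tsum_le_tsum (X.norm_shiftFun_succ_le x f)
        ((X.hasSum_sq f).summable.mul_left _)
      rw [tsum_mul_left, (X.hasSum_sq f).tsum_eq, ← mul_pow] at h2
      have h3 := h.tsum_eq_zero_add
      have h4 : ‖X.shiftFun x f 0‖ ^ 2 = 0 := by simp [shiftFun]
      rw [h4, zero_add] at h3
      simpa [h3] using h2)

theorem shift_apply_zero (X : SubproductSystem) (x : X.fiber 1) (f : X.Fock) :
    X.shift x f 0 = 0 := rfl

theorem shift_apply_succ (X : SubproductSystem) (x : X.fiber 1) (f : X.Fock) (n : ℕ) :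
    X.shift x f (n + 1) =
      HilbertTensor.proj (X.incl 1 n (n + 1) (Nat.add_comm 1 n)) x (f n) := rfl

/-- The tensor algebra of `X`: the norm closed unital subalgebra of `B(𝓕_X)` generated by the
shifts. -/
def tensorAlgebra (X : SubproductSystem) : Subalgebra ℂ (X.Fock →L[ℂ] X.Fock) :=
  (Algebra.adjoin ℂ (Set.range X.shift)).topologicalClosure

/-- The vacuum vector `1 ∈ ℂ = X 0`. -/
def vacuum (X : SubproductSystem) : X.Fock := lp.single 2 0 (X.zeroIso.symm 1)

theorem inner_vacuum (X : SubproductSystem) (f : X.Fock) :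
    inner ℂ X.vacuum f = X.zeroIso (f 0) := by
  rw [vacuum, lp.inner_single_left, ← X.zeroIso.inner_map_map]
  simp

/-- Elements of the tensor algebra do not lower degrees, and their degree zero part is the
scalar `⟨Ω, T Ω⟩`. -/
theorem tensorAlgebra_diag (X : SubproductSystem) {T : X.Fock →L[ℂ] X.Fock}
    (hT : T ∈ X.tensorAlgebra) (m : ℕ) (f : X.Fock) (hf : ∀ k < m, f k = 0) :
    (∀ k < m, T f k = 0) ∧ T f m = inner ℂ X.vacuum (T X.vacuum) • f m := by
  have hev : ∀ (f : X.Fock) (k : ℕ), Continuous fun T : X.Fock →L[ℂ] X.Fock => T f k :=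
    fun f k => (lp.evalCLM ℂ X.fiber 2 k).continuous.comp (ContinuousLinearMap.apply ℂ _ f).continuous
  have hc : Continuous fun T : X.Fock →L[ℂ] X.Fock => inner ℂ X.vacuum (T X.vacuum) :=
    continuous_const.inner (ContinuousLinearMap.apply ℂ _ X.vacuum).continuous
  have hvac : inner ℂ X.vacuum X.vacuum = (1 : ℂ) := by
    rw [inner_vacuum]; simp [vacuum]
  let s : Set (X.Fock →L[ℂ] X.Fock) := {T | ∀ (m : ℕ) (f : X.Fock), (∀ k < m, f k = 0) →
    (∀ k < m, T f k = 0) ∧ T f m = (inner ℂ X.vacuum (T X.vacuum) : ℂ) • f m}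
  have hs : IsClosed s := by
    simp only [s, Set.ofPred_forall]
    refine isClosed_iInter fun m => isClosed_iInter fun f => isClosed_iInter fun _ => ?_
    refine IsClosed.and ?_ (isClosed_eq (hev f m) (hc.smul continuous_const))
    simp only [Set.ofPred_forall]
    exact isClosed_iInter fun k => isClosed_iInter fun _ => isClosed_eq (hev f k) continuous_const
  suffices h : (X.tensorAlgebra : Set (X.Fock →L[ℂ] X.Fock)) ⊆ s from h hT m f hf
  rw [tensorAlgebra, Subalgebra.topologicalClosure_coe]
  refine closure_minimal (fun T hT => ?_) hs
  induction hT using Algebra.adjoin_induction with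
  | mem T hT =>
    obtain ⟨x, rfl⟩ := hT
    intro m f hf
    have h0 : ∀ k < m + 1, X.shift x f k = 0 := by
      intro k hk
      cases k with
      | zero => rfl
      | succ k =>
        rw [shift_apply_succ, hf k (by omega)]
        simpa using HilbertTensor.proj_smul (X.incl 1 k (k + 1) (Nat.add_comm 1 k)) x 0 0
    refine ⟨fun k hk => h0 k (by omega), ?_⟩
    rw [h0 m (by omega), inner_vacuum, shift_apply_zero]
    simp
  | algebraMap c =>
    intro m f hf
    simp only [Algebra.algebraMap_eq_smul_one, smul_apply, one_apply_eq_self]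
    refine ⟨fun k hk => by simp [hf k hk], ?_⟩
    rw [inner_smul_right, hvac]
    simp
  | add T U _ _ hT hU =>
    intro m f hf
    refine ⟨fun k hk => by simp [(hT m f hf).1 k hk, (hU m f hf).1 k hk], ?_⟩
    simp [(hT m f hf).2, (hU m f hf).2, add_smul]
  | mul T U _ _ hT hU =>
    intro m f hf
    have h1 := hU m f hf
    have h2 := hT m (U f) h1.1
    refine ⟨h2.1, ?_⟩
    have h3 := (hT 0 (U X.vacuum) (by simp)).2
    change T (U f) m = (inner ℂ X.vacuum (T (U X.vacuum)) : ℂ) • f m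
    rw [h2.2, h1.2, X.inner_vacuum (T (U _)), h3, map_smul, ← X.inner_vacuum (U _), smul_smul,
      smul_eq_mul]

/-- The vacuum state `Φ₀`, `T ↦ ⟨Ω, T Ω⟩`, a unital homomorphism from the tensor algebra to `ℂ`;
by `tensorAlgebra_diag` it gives the degree zero component of `T`. -/
def vacuumState (X : SubproductSystem) : X.tensorAlgebra →ₐ[ℂ] ℂ :=
  AlgHom.ofLinearMap
    { toFun := fun T => inner ℂ X.vacuum ((T : X.Fock →L[ℂ] X.Fock) X.vacuum)
      map_add' := fun T U => by simp
      map_smul' := fun c T => by simp }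
    (by
      change inner ℂ X.vacuum X.vacuum = (1 : ℂ)
      rw [inner_vacuum]
      simp [vacuum])
    (fun T U => by
      have h := (X.tensorAlgebra_diag T.2 0
        ((U : X.Fock →L[ℂ] X.Fock) X.vacuum) (by simp)).2
      change inner ℂ X.vacuum ((T : X.Fock →L[ℂ] X.Fock) ((U : X.Fock →L[ℂ] X.Fock) X.vacuum))
        = inner ℂ X.vacuum ((T : X.Fock →L[ℂ] X.Fock) X.vacuum) *
          inner ℂ X.vacuum ((U : X.Fock →L[ℂ] X.Fock) X.vacuum)
      rw [X.inner_vacuum (_), h, map_smul, ← X.inner_vacuum, smul_eq_mul])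

/-- `φ : 𝓐_X → 𝓐_Y` is vacuum preserving: `φ*` maps the vacuum state of `𝓐_Y` to that of
`𝓐_X`. -/
def VacuumPreserving {X Y : SubproductSystem} (φ : X.tensorAlgebra ≃ₐ[ℂ] Y.tensorAlgebra) :
    Prop :=
  Y.vacuumState.comp φ.toAlgHom = X.vacuumState

end SubproductSystem

/-- A linear map `φ : A → B` between algebras of Hilbert space operators is completely bounded:
the maps `[a i j] ↦ [φ (a i j)]` from `M_n(A) ⊆ M_n(B(H))` to `M_n(B) ⊆ M_n(B(K))` are bounded
uniformly in `n`, where `M_n(B(H)) = B(Hⁿ)` has its norm as a C⋆-algebra. -/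
def IsCompletelyBounded {H K : Type*} [NormedAddCommGroup H] [InnerProductSpace ℂ H]
    [CompleteSpace H] [NormedAddCommGroup K] [InnerProductSpace ℂ K] [CompleteSpace K]
    {A : Subalgebra ℂ (H →L[ℂ] H)} {B : Subalgebra ℂ (K →L[ℂ] K)} (φ : A →ₗ[ℂ] B) : Prop :=
  ∃ C : ℝ, ∀ (n : ℕ) (a : Matrix (Fin n) (Fin n) A),
    ‖CStarMatrix.ofMatrix (a.map fun x => (φ x : K →L[ℂ] K))‖ ≤
      C * ‖CStarMatrix.ofMatrix (a.map fun x => (x : H →L[ℂ] H))‖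

end

/-! A character χ of `X.tensorAlgebra` is automatically contractive, hence determined by the vector
b of the unit ball of `X.fiber 1` representing it on the generators. If b ≠ 0, then χ behaves on
degree n like the n-th tensor power of b. The geometric series built from these powers, with b
normalised, gives joint eigenvectors of the adjoint shifts, so the vacuum state lies at the centre
of a holomorphic disc of characters in the direction of b (`exists_disc`).

Given φ, pull the vacuum state of `Y` back to `X`, and that of `X` back to `Y` by φ⁻¹. If these are
not the vacuum states, their points have norms r and s less than 1, by the maximum principle.
Pulling the disc of `Y` back by φ, reparametrised by the disc involution exchanging 0 and s, gives a
disc of characters of `X` centred at the vacuum. The Schwarz lemma gives r ≤ s; by symmetry r = s,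
and equality in the Schwarz lemma makes the disc linear. Thus φ carries disc to disc by a Möbius
involution, while gauge automorphisms rotate both discs.

That involution moves some point of the circle |z| = r to another point of the same circle.
Comparing the characters there yields u, v with Φ_X φ⁻¹ γ_u φ = Φ_Y φ γ_v
(`exists_gauge_intertwining`), so φ γ_v φ⁻¹ γ_u⁻¹ φ preserves the vacuum. Gauge automorphisms are
unitarily implemented, hence completely isometric, so the metric properties of φ and φ⁻¹ survive. -/

noncomputable section

/-! ### Totality of elementary tensors and vectors that factor. -/

namespace HilbertTensor

variable {E F G : Type*} [NormedAddCommGroup E] [InnerProductSpace ℂ E]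
  [NormedAddCommGroup F] [InnerProductSpace ℂ F]
  [NormedAddCommGroup G] [InnerProductSpace ℂ G] [CompleteSpace G]

theorem proj_add_left (ι : G →ₗᵢ[ℂ] HilbertTensor E F) (x y : E) (z : F) :
    proj ι (x + y) z = proj ι x z + proj ι y z := by
  simp only [proj, TensorProduct.add_tmul, UniformSpace.Completion.coe_add, map_add]

theorem proj_smul_left (ι : G →ₗᵢ[ℂ] HilbertTensor E F) (c : ℂ) (x : E) (z : F) :
    proj ι (c • x) z = c • proj ι x z := by
  simp only [proj, ← TensorProduct.smul_tmul', UniformSpace.Completion.coe_smul, map_smul]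

theorem proj_zero_right (ι : G →ₗᵢ[ℂ] HilbertTensor E F) (x : E) : proj ι x 0 = 0 := by
  simpa using proj_smul ι x 0 0

theorem inner_proj (ι : G →ₗᵢ[ℂ] HilbertTensor E F) (g : G) (x : E) (y : F) :
    inner ℂ g (proj ι x y) =
      inner ℂ (ι g) ((x ⊗ₜ[ℂ] y : E ⊗[ℂ] F) : HilbertTensor E F) := by
  rw [proj, ContinuousLinearMap.adjoint_inner_right]
  rfl

/-- The elementary tensors are total in the Hilbert tensor product. -/
theorem closed_submodule_eq_top (M : Submodule ℂ (HilbertTensor E F))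
    (hM : IsClosed (M : Set (HilbertTensor E F)))
    (h : ∀ x y, ((x ⊗ₜ[ℂ] y : E ⊗[ℂ] F) : HilbertTensor E F) ∈ M) : M = ⊤ := by
  refine (Submodule.eq_top_iff'.2 fun ζ => ?_)
  induction ζ using UniformSpace.Completion.induction_on with
  | hp => exact hM
  | ih a =>
    induction a using TensorProduct.induction_on with
    | zero => rw [UniformSpace.Completion.coe_zero]; exact M.zero_mem
    | tmul x y => exact h x y
    | add a b ha hb => rw [UniformSpace.Completion.coe_add]; exact M.add_mem ha hb

/-- The projections of elementary tensors are total. -/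
theorem submodule_eq_top_of_proj_mem (ι : G →ₗᵢ[ℂ] HilbertTensor E F) (M : Submodule ℂ G)
    (hM : IsClosed (M : Set G)) (h : ∀ x y, proj ι x y ∈ M) : M = ⊤ := by
  have h1 := closed_submodule_eq_top
    (M.comap (ContinuousLinearMap.adjoint ι.toContinuousLinearMap).toLinearMap)
    (hM.preimage (ContinuousLinearMap.adjoint ι.toContinuousLinearMap).continuous) h
  refine Submodule.eq_top_iff'.2 fun g => ?_
  have h2 := Submodule.eq_top_iff'.1 h1 (ι g)
  have h3 : ContinuousLinearMap.adjoint ι.toContinuousLinearMap (ι g) = g := by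
    refine ext_inner_left ℂ fun v => ?_
    rw [ContinuousLinearMap.adjoint_inner_right]
    exact ι.inner_map_map v g
  rw [Submodule.mem_comap] at h2
  change ContinuousLinearMap.adjoint ι.toContinuousLinearMap (ι g) ∈ M at h2
  rwa [h3] at h2

/-- Both sides define functionals that agree on elementary tensors, and these are total. -/
theorem incl_eq_tmul (ι : G →ₗᵢ[ℂ] HilbertTensor E F) (g : G) (e : E) (f : F)
    (h : ∀ x y, inner ℂ g (proj ι x y) = inner ℂ e x * inner ℂ f y) :
    ι g = ((e ⊗ₜ[ℂ] f : E ⊗[ℂ] F) : HilbertTensor E F) := by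
  let ℓ : HilbertTensor E F →L[ℂ] ℂ :=
    innerSL ℂ (ι g) - innerSL ℂ ((e ⊗ₜ[ℂ] f : E ⊗[ℂ] F) : HilbertTensor E F)
  have h1 := closed_submodule_eq_top ℓ.ker ℓ.isClosed_ker fun x y => by
    have := h x y
    rw [inner_proj] at this
    simp [ℓ, this]
  refine ext_inner_right ℂ fun ζ => ?_
  have h2 := Submodule.eq_top_iff'.1 h1 ζ
  simpa [ℓ, sub_eq_zero] using h2

theorem norm_eq_mul_of_inner_proj (ι : G →ₗᵢ[ℂ] HilbertTensor E F) (g : G) (e : E) (f : F)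
    (h : ∀ x y, inner ℂ g (proj ι x y) = inner ℂ e x * inner ℂ f y) : ‖g‖ = ‖e‖ * ‖f‖ := by
  rw [← ι.norm_map, incl_eq_tmul ι g e f h, UniformSpace.Completion.norm_coe,
    TensorProduct.norm_tmul]

end HilbertTensor

/-- A closed subalgebra is itself a Banach algebra, where characters are automatically bounded. This
is why a purely algebraic isomorphism suffices later. -/
theorem Subalgebra.norm_character_le {B : Type*} [NormedRing B] [NormedAlgebra ℂ B]
    [CompleteSpace B] {A : Subalgebra ℂ B} (hA : IsClosed (A : Set B)) (h1 : ‖(1 : B)‖ ≤ 1)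
    (χ : A →ₐ[ℂ] ℂ) (T : A) : ‖χ T‖ ≤ ‖T‖ := by
  have := hA.completeSpace_coe
  exact (AlgHom.norm_apply_le_self_mul_norm_one χ T).trans
    (mul_le_of_le_one_right (norm_nonneg _) h1)

theorem Subalgebra.continuous_character {B : Type*} [NormedRing B] [NormedAlgebra ℂ B]
    [CompleteSpace B] {A : Subalgebra ℂ B} (hA : IsClosed (A : Set B)) (h1 : ‖(1 : B)‖ ≤ 1)
    (χ : A →ₐ[ℂ] ℂ) : Continuous χ :=
  AddMonoidHomClass.continuous_of_bound χ 1 fun T => by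
    rw [one_mul]
    exact Subalgebra.norm_character_le hA h1 χ T

/-! ### Homogeneous operators in the tensor algebra. -/

namespace SubproductSystem

variable (X : SubproductSystem)

/-- The components of `S_n(ξ) f`, for `ξ ∈ X n`. -/
def homShiftFun (n : ℕ) (ξ : X.fiber n) (f : X.Fock) (k : ℕ) : X.fiber k :=
  if h : n ≤ k then HilbertTensor.proj (X.incl n (k - n) k (by omega)) ξ (f (k - n)) else 0

theorem homShiftFun_of_add_eq {n j k : ℕ} (h : n + j = k) (ξ : X.fiber n) (f : X.Fock) :
    X.homShiftFun n ξ f k = HilbertTensor.proj (X.incl n j k h) ξ (f j) := by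
  obtain rfl : j = k - n := by omega
  rw [homShiftFun, dif_pos (by omega)]

theorem homShiftFun_of_lt {n k : ℕ} (h : k < n) (ξ : X.fiber n) (f : X.Fock) :
    X.homShiftFun n ξ f k = 0 := dif_neg (by omega)

theorem norm_homShiftFun_add_le (n : ℕ) (ξ : X.fiber n) (f : X.Fock) (j : ℕ) :
    ‖X.homShiftFun n ξ f (j + n)‖ ^ 2 ≤ ‖ξ‖ ^ 2 * ‖f j‖ ^ 2 := by
  rw [← mul_pow, X.homShiftFun_of_add_eq (Nat.add_comm n j)]
  exact pow_le_pow_left₀ (norm_nonneg _) (HilbertTensor.norm_proj_le _ _ _) 2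

theorem summable_homShiftFun (n : ℕ) (ξ : X.fiber n) (f : X.Fock) :
    Summable fun k => ‖X.homShiftFun n ξ f k‖ ^ 2 := by
  rw [← summable_nat_add_iff n]
  exact Summable.of_nonneg_of_le (fun n => by positivity) (X.norm_homShiftFun_add_le n ξ f)
    ((X.hasSum_sq f).summable.mul_left _)

/-- The operator `S_n(ξ)`, `ξ ∈ X n`, on the Fock space, mapping `y ∈ X m` to `p (ξ ⊗ y)`. -/
def homShift (n : ℕ) : X.fiber n →L[ℂ] X.Fock →L[ℂ] X.Fock :=
  LinearMap.mkContinuous₂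
    (LinearMap.mk₂ ℂ
      (fun ξ f => (⟨X.homShiftFun n ξ f,
        memℓp_gen (by simpa using X.summable_homShiftFun n ξ f)⟩ : X.Fock))
      (fun ξ η f => by
        ext k
        change X.homShiftFun n (ξ + η) f k = X.homShiftFun n ξ f k + X.homShiftFun n η f k
        by_cases h : n ≤ k
        · simp only [X.homShiftFun_of_add_eq (Nat.add_sub_cancel' h),
            HilbertTensor.proj_add_left]
        · simp [X.homShiftFun_of_lt (not_le.1 h)])
      (fun c ξ f => by
        ext k
        change X.homShiftFun n (c • ξ) f k = c • X.homShiftFun n ξ f k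
        by_cases h : n ≤ k
        · simp only [X.homShiftFun_of_add_eq (Nat.add_sub_cancel' h),
            HilbertTensor.proj_smul_left]
        · simp [X.homShiftFun_of_lt (not_le.1 h)])
      (fun ξ f g => by
        ext k
        change X.homShiftFun n ξ (f + g) k = X.homShiftFun n ξ f k + X.homShiftFun n ξ g k
        by_cases h : n ≤ k
        · simp only [X.homShiftFun_of_add_eq (Nat.add_sub_cancel' h), lp.coeFn_add, Pi.add_apply,
            HilbertTensor.proj_add]
        · simp [X.homShiftFun_of_lt (not_le.1 h)])
      (fun c ξ f => by
        ext k
        change X.homShiftFun n ξ (c • f) k = c • X.homShiftFun n ξ f k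
        by_cases h : n ≤ k
        · simp only [X.homShiftFun_of_add_eq (Nat.add_sub_cancel' h), lp.coeFn_smul, Pi.smul_apply,
            HilbertTensor.proj_smul]
        · simp [X.homShiftFun_of_lt (not_le.1 h)]))
    1 (fun ξ f => by
      rw [one_mul]
      refine lp.norm_le_of_tsum_le (by norm_num) (by positivity) ?_
      have h := X.summable_homShiftFun n ξ f
      have h2 := ((summable_nat_add_iff n).2 h).tsum_le_tsum (X.norm_homShiftFun_add_le n ξ f)
        ((X.hasSum_sq f).summable.mul_left _)
      rw [tsum_mul_left, (X.hasSum_sq f).tsum_eq, ← mul_pow] at h2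
      have h3 := h.sum_add_tsum_nat_add n
      rw [Finset.sum_eq_zero (fun k hk => by
        rw [X.homShiftFun_of_lt (Finset.mem_range.1 hk)]; simp), zero_add] at h3
      rw [h3] at h2
      simpa using h2)

theorem homShift_apply_of_add_eq {n j k : ℕ} (h : n + j = k) (ξ : X.fiber n) (f : X.Fock) :
    X.homShift n ξ f k = HilbertTensor.proj (X.incl n j k h) ξ (f j) :=
  X.homShiftFun_of_add_eq h ξ f

theorem homShift_apply_of_lt {n k : ℕ} (h : k < n) (ξ : X.fiber n) (f : X.Fock) :
    X.homShift n ξ f k = 0 := X.homShiftFun_of_lt h ξ f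

theorem norm_homShift_le (n : ℕ) (ξ : X.fiber n) : ‖X.homShift n ξ‖ ≤ ‖ξ‖ := by
  have h : ‖X.homShift n‖ ≤ 1 := LinearMap.mkContinuous₂_norm_le _ zero_le_one _
  simpa using (X.homShift n).le_of_opNorm_le h ξ

theorem homShift_zero (ξ : X.fiber 0) : X.homShift 0 ξ = X.zeroIso ξ • 1 := by
  have h : ξ = X.zeroIso ξ • X.zeroIso.symm 1 := by
    rw [← map_smul, smul_eq_mul, mul_one, LinearIsometryEquiv.symm_apply_apply]
  ext f k
  rw [X.homShift_apply_of_add_eq (Nat.zero_add k)]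
  conv_lhs => rw [h, HilbertTensor.proj_smul_left, X.one_proj]
  rfl

/-- This is associativity of the subproduct system, read degree by degree. -/
theorem shift_mul_homShift (n : ℕ) (x : X.fiber 1) (ξ : X.fiber n) :
    X.shift x * X.homShift n ξ =
      X.homShift (n + 1) (HilbertTensor.proj (X.incl 1 n (n + 1) (Nat.add_comm 1 n)) x ξ) := by
  ext f k
  change X.shift x (X.homShift n ξ f) k = _
  cases k with
  | zero => rw [shift_apply_zero, homShift_apply_of_lt _ (Nat.succ_pos n)]
  | succ k =>
    rw [shift_apply_succ]
    by_cases h : n ≤ k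
    · obtain ⟨j, rfl⟩ := Nat.exists_eq_add_of_le h
      rw [X.homShift_apply_of_add_eq rfl, X.homShift_apply_of_add_eq (j := j) (by omega)]
      exact (X.assoc _ _ _ _ _ _ _ _ _ _ _ _ _).symm
    · rw [X.homShift_apply_of_lt (not_le.1 h), X.homShift_apply_of_lt (by omega),
        HilbertTensor.proj_zero_right]

theorem isClosed_tensorAlgebra :
    IsClosed (X.tensorAlgebra : Set (X.Fock →L[ℂ] X.Fock)) :=
  Subalgebra.isClosed_topologicalClosure _

theorem shift_mem (x : X.fiber 1) : X.shift x ∈ X.tensorAlgebra :=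
  Subalgebra.le_topologicalClosure _ (Algebra.subset_adjoin ⟨x, rfl⟩)

theorem homShift_mem (n : ℕ) (ξ : X.fiber n) : X.homShift n ξ ∈ X.tensorAlgebra := by
  induction n with
  | zero =>
    rw [homShift_zero]
    exact X.tensorAlgebra.smul_mem X.tensorAlgebra.one_mem _
  | succ n ih =>
    -- The vectors p(x ⊗ η) are total in degree n + 1, and membership is a closed linear condition
    -- on ξ.
    have := HilbertTensor.submodule_eq_top_of_proj_mem (X.incl 1 n (n + 1) (Nat.add_comm 1 n))
      ((Subalgebra.toSubmodule X.tensorAlgebra).comap (X.homShift (n + 1)).toLinearMap)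
      (X.isClosed_tensorAlgebra.preimage (X.homShift (n + 1)).continuous) fun x η => by
        change X.homShift (n + 1) _ ∈ X.tensorAlgebra
        rw [← shift_mul_homShift]
        exact X.tensorAlgebra.mul_mem (X.shift_mem x) (ih η)
    exact Submodule.eq_top_iff'.1 this ξ

/-- The generator `S(x)` as an element of the tensor algebra. -/
def gen (x : X.fiber 1) : X.tensorAlgebra := ⟨X.shift x, X.shift_mem x⟩

theorem norm_shift_le (x : X.fiber 1) : ‖X.shift x‖ ≤ ‖x‖ :=
  LinearMap.mkContinuous_norm_le _ (norm_nonneg _) _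

theorem gen_add (x y : X.fiber 1) : X.gen (x + y) = X.gen x + X.gen y := by
  refine Subtype.ext (ContinuousLinearMap.ext fun f => lp.ext (funext fun k => ?_))
  change X.shift (x + y) f k = X.shift x f k + X.shift y f k
  cases k with
  | zero => simp [shift_apply_zero]
  | succ k => simp only [shift_apply_succ, HilbertTensor.proj_add_left]

theorem gen_smul (c : ℂ) (x : X.fiber 1) : X.gen (c • x) = c • X.gen x := by
  refine Subtype.ext (ContinuousLinearMap.ext fun f => lp.ext (funext fun k => ?_))
  change X.shift (c • x) f k = c • X.shift x f k
  cases k with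
  | zero => simp [shift_apply_zero]
  | succ k => simp only [shift_apply_succ, HilbertTensor.proj_smul_left]

/-! ### Characters and their representing vectors. -/

theorem norm_character_le (χ : X.tensorAlgebra →ₐ[ℂ] ℂ) (T : X.tensorAlgebra) : ‖χ T‖ ≤ ‖T‖ :=
  Subalgebra.norm_character_le X.isClosed_tensorAlgebra ContinuousLinearMap.norm_id_le χ T

theorem continuous_character (χ : X.tensorAlgebra →ₐ[ℂ] ℂ) : Continuous χ :=
  Subalgebra.continuous_character X.isClosed_tensorAlgebra ContinuousLinearMap.norm_id_le χ

theorem norm_character_gen_le (χ : X.tensorAlgebra →ₐ[ℂ] ℂ) (x : X.fiber 1) :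
    ‖χ (X.gen x)‖ ≤ ‖x‖ :=
  (X.norm_character_le χ _).trans (X.norm_shift_le x)

/-- Induction for the tensor algebra: a closed subalgebra containing the generators is
everything. -/
theorem subalgebra_eq_top (B : Subalgebra ℂ X.tensorAlgebra)
    (hB : IsClosed (B : Set X.tensorAlgebra)) (h : ∀ x, X.gen x ∈ B) : B = ⊤ := by
  have h1 : X.tensorAlgebra ≤ B.map X.tensorAlgebra.val := by
    refine Subalgebra.topologicalClosure_minimal (Algebra.adjoin_le ?_) ?_
    · rintro _ ⟨x, rfl⟩
      exact ⟨X.gen x, h x, rfl⟩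
    · exact X.isClosed_tensorAlgebra.isClosedEmbedding_subtypeVal.isClosedMap _ hB
  refine Algebra.eq_top_iff.2 fun T => ?_
  obtain ⟨U, hU, hUT⟩ := h1 T.2
  rwa [← Subtype.ext hUT]

theorem character_ext {χ₁ χ₂ : X.tensorAlgebra →ₐ[ℂ] ℂ}
    (h : ∀ x, χ₁ (X.gen x) = χ₂ (X.gen x)) : χ₁ = χ₂ := by
  have := X.subalgebra_eq_top (AlgHom.equalizer χ₁ χ₂)
    (isClosed_eq (X.continuous_character χ₁) (X.continuous_character χ₂)) h
  ext T
  exact Algebra.eq_top_iff.1 this T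

theorem vacuumState_gen (x : X.fiber 1) : X.vacuumState (X.gen x) = 0 := by
  change inner ℂ X.vacuum (X.shift x X.vacuum) = (0 : ℂ)
  rw [inner_vacuum, shift_apply_zero, map_zero]

/-- The vector representing a character on the generators. -/
def point (χ : X.tensorAlgebra →ₐ[ℂ] ℂ) : X.fiber 1 :=
  (InnerProductSpace.toDual ℂ (X.fiber 1)).symm
    (LinearMap.mkContinuous
      { toFun := fun x => χ (X.gen x)
        map_add' := fun x y => by rw [gen_add]; exact χ.toLinearMap.map_add _ _
        map_smul' := fun c x => by rw [gen_smul]; exact χ.toLinearMap.map_smul _ _ } 1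
      fun x => by rw [one_mul]; exact X.norm_character_gen_le χ x)

theorem inner_point (χ : X.tensorAlgebra →ₐ[ℂ] ℂ) (x : X.fiber 1) :
    inner ℂ (X.point χ) x = χ (X.gen x) := by
  rw [point, InnerProductSpace.toDual_symm_apply]
  rfl

theorem norm_point_le_one (χ : X.tensorAlgebra →ₐ[ℂ] ℂ) : ‖X.point χ‖ ≤ 1 := by
  -- Evaluating χ at its own point b gives ‖b‖² ≤ ‖b‖.
  have h := X.norm_character_gen_le χ (X.point χ)
  rw [← inner_point, inner_self_eq_norm_sq_to_K] at h
  simp only [norm_pow, Complex.coe_algebraMap, Complex.norm_real, norm_norm] at h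
  nlinarith [norm_nonneg (X.point χ)]

theorem point_ne_zero {χ : X.tensorAlgebra →ₐ[ℂ] ℂ} (h : χ ≠ X.vacuumState) :
    X.point χ ≠ 0 := by
  contrapose! h
  refine X.character_ext fun x => ?_
  rw [← inner_point, h, vacuumState_gen, inner_zero_left]

/-- The vector representing a character on the homogeneous elements of degree `n`. -/
def homPoint (χ : X.tensorAlgebra →ₐ[ℂ] ℂ) (n : ℕ) : X.fiber n :=
  (InnerProductSpace.toDual ℂ (X.fiber n)).symm
    (LinearMap.mkContinuous
      { toFun := fun ξ => χ ⟨X.homShift n ξ, X.homShift_mem n ξ⟩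
        map_add' := fun ξ η => by
          rw [← χ.toLinearMap_apply, ← χ.toLinearMap_apply, ← χ.toLinearMap_apply,
            ← χ.toLinearMap.map_add]
          congr 1; exact Subtype.ext (map_add _ _ _)
        map_smul' := fun c ξ => by
          rw [RingHom.id_apply, ← χ.toLinearMap_apply, ← χ.toLinearMap_apply,
            ← χ.toLinearMap.map_smul]
          congr 1; exact Subtype.ext (map_smul _ _ _) } 1
      fun ξ => by
        rw [one_mul]
        exact (X.norm_character_le χ _).trans (X.norm_homShift_le n ξ))

theorem inner_homPoint (χ : X.tensorAlgebra →ₐ[ℂ] ℂ) (n : ℕ) (ξ : X.fiber n) :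
    inner ℂ (X.homPoint χ n) ξ = χ ⟨X.homShift n ξ, X.homShift_mem n ξ⟩ := by
  rw [homPoint, InnerProductSpace.toDual_symm_apply]
  rfl

theorem inner_homPoint_zero (χ : X.tensorAlgebra →ₐ[ℂ] ℂ) (ξ : X.fiber 0) :
    inner ℂ (X.homPoint χ 0) ξ = X.zeroIso ξ := by
  have : (⟨X.homShift 0 ξ, X.homShift_mem 0 ξ⟩ : X.tensorAlgebra) = X.zeroIso ξ • 1 :=
    Subtype.ext (X.homShift_zero ξ)
  rw [inner_homPoint, this, ← χ.toLinearMap_apply, χ.toLinearMap.map_smul, χ.toLinearMap_apply,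
    map_one, smul_eq_mul, mul_one]

theorem inner_homPoint_succ (χ : X.tensorAlgebra →ₐ[ℂ] ℂ) (n : ℕ) (x : X.fiber 1)
    (ξ : X.fiber n) :
    inner ℂ (X.homPoint χ (n + 1))
      (HilbertTensor.proj (X.incl 1 n (n + 1) (Nat.add_comm 1 n)) x ξ) =
      inner ℂ (X.point χ) x * inner ℂ (X.homPoint χ n) ξ := by
  rw [inner_homPoint, inner_homPoint, inner_point, ← map_mul]
  congr 1
  exact Subtype.ext (X.shift_mul_homShift n x ξ).symm

/-- Multiplicativity of χ identifies the vector of degree n + 1 with b ⊗ (vector of degree n), where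
b is the point of χ. -/
theorem norm_homPoint (χ : X.tensorAlgebra →ₐ[ℂ] ℂ) (n : ℕ) :
    ‖X.homPoint χ n‖ = ‖X.point χ‖ ^ n := by
  induction n with
  | zero =>
    have h : X.homPoint χ 0 = X.zeroIso.symm 1 := by
      refine ext_inner_right ℂ fun ξ => ?_
      rw [inner_homPoint_zero, ← X.zeroIso.inner_map_map]
      simp
    rw [h]; simp
  | succ n ih =>
    rw [HilbertTensor.norm_eq_mul_of_inner_proj _ _ _ _ (X.inner_homPoint_succ χ n), ih, pow_succ']

end SubproductSystem

/-! ### Joint eigenvectors and holomorphic discs of characters. -/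

namespace SubproductSystem

variable (X : SubproductSystem)

/-- Being an eigenvector of T* is a closed condition on T, stable under sums and products; the
normalisation `hw` reads the eigenvalue off the vacuum vector. -/
theorem inner_apply_of_joint_eigenvector {w : X.Fock} (hw : inner ℂ w X.vacuum = (1 : ℂ))
    {c : X.fiber 1 → ℂ} (hc : ∀ x f, inner ℂ w (X.shift x f) = c x * inner ℂ w f)
    (T : X.tensorAlgebra) (f : X.Fock) :
    inner ℂ w ((T : X.Fock →L[ℂ] X.Fock) f) =
      inner ℂ w ((T : X.Fock →L[ℂ] X.Fock) X.vacuum) * inner ℂ w f := by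
  have hcont : ∀ f : X.Fock, Continuous fun T : X.Fock →L[ℂ] X.Fock => (inner ℂ w (T f) : ℂ) :=
    fun f => continuous_const.inner (ContinuousLinearMap.apply ℂ _ f).continuous
  let s : Set (X.Fock →L[ℂ] X.Fock) :=
    {T | ∀ f, inner ℂ w (T f) = (inner ℂ w (T X.vacuum) * inner ℂ w f : ℂ)}
  have hs : IsClosed s := by
    simp only [s, Set.ofPred_forall]
    exact isClosed_iInter fun f => isClosed_eq (hcont f) ((hcont _).mul continuous_const)
  suffices h : (X.tensorAlgebra : Set (X.Fock →L[ℂ] X.Fock)) ⊆ s from h T.2 f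
  rw [tensorAlgebra, Subalgebra.topologicalClosure_coe]
  refine closure_minimal (fun T hT => ?_) hs
  induction hT using Algebra.adjoin_induction with
  | mem T hT =>
    obtain ⟨x, rfl⟩ := hT
    intro f
    rw [hc, hc, hw, mul_one]
  | algebraMap a =>
    intro f
    simp only [Algebra.algebraMap_eq_smul_one, smul_apply, one_apply_eq_self,
      inner_smul_right, hw, mul_one]
  | add T U _ _ hT hU =>
    intro f
    simp only [add_apply, inner_add_right, hT f, hU f, add_mul]
  | mul T U _ _ hT hU =>
    intro f
    change inner ℂ w (T (U f)) = (inner ℂ w (T (U X.vacuum)) * inner ℂ w f : ℂ)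
    rw [hT (U f), hU f, hT (U X.vacuum), mul_assoc]

/-- A joint eigenvector of the adjoints of the shifts gives a character. -/
def eigenCharacter (w : X.Fock) (hw : inner ℂ w X.vacuum = (1 : ℂ))
    (c : X.fiber 1 → ℂ) (hc : ∀ x f, inner ℂ w (X.shift x f) = c x * inner ℂ w f) :
    X.tensorAlgebra →ₐ[ℂ] ℂ :=
  AlgHom.ofLinearMap
    { toFun := fun T => inner ℂ w ((T : X.Fock →L[ℂ] X.Fock) X.vacuum)
      map_add' := fun T U => by simp
      map_smul' := fun c T => by simp }
    hw
    (fun T U => X.inner_apply_of_joint_eigenvector hw hc T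
      ((U : X.Fock →L[ℂ] X.Fock) X.vacuum))

theorem eigenCharacter_apply (w : X.Fock) (hw : inner ℂ w X.vacuum = (1 : ℂ))
    (c : X.fiber 1 → ℂ) (hc : ∀ x f, inner ℂ w (X.shift x f) = c x * inner ℂ w f)
    (T : X.tensorAlgebra) :
    X.eigenCharacter w hw c hc T = inner ℂ w ((T : X.Fock →L[ℂ] X.Fock) X.vacuum) := rfl

theorem eigenCharacter_gen (w : X.Fock) (hw : inner ℂ w X.vacuum = (1 : ℂ))
    (c : X.fiber 1 → ℂ) (hc : ∀ x f, inner ℂ w (X.shift x f) = c x * inner ℂ w f)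
    (x : X.fiber 1) : X.eigenCharacter w hw c hc (X.gen x) = c x := by
  rw [eigenCharacter_apply]
  change inner ℂ w (X.shift x X.vacuum) = _
  rw [hc, hw, mul_one]

section Disc

variable (χ : X.tensorAlgebra →ₐ[ℂ] ℂ) (z : ℂ)

/-- The components of the joint eigenvector at the point `z / ‖b‖ • b`, where `b` is the point
of the character `χ`. -/
def discFun (n : ℕ) : X.fiber n :=
  ((starRingEnd ℂ z) / ‖X.point χ‖) ^ n • X.homPoint χ n

/-- Dividing by the norm of the point makes the series geometric in |z|, so the disc has radius 1
whatever the length of the point. -/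
theorem norm_discFun (h : X.point χ ≠ 0) (n : ℕ) : ‖X.discFun χ z n‖ = ‖z‖ ^ n := by
  have : ‖X.point χ‖ ≠ 0 := norm_ne_zero_iff.2 h
  rw [discFun, norm_smul, norm_homPoint, norm_pow, ← mul_pow]
  simp [this]

/-- The conjugate in `discFun` cancels the antilinearity of the first slot, so pairings are
holomorphic in z. -/
theorem inner_discFun (n : ℕ) (ξ : X.fiber n) :
    inner ℂ (X.discFun χ z n) ξ = (z / ‖X.point χ‖) ^ n * inner ℂ (X.homPoint χ n) ξ := by
  rw [discFun, inner_smul_left]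
  simp

variable {χ z} (h : X.point χ ≠ 0) (hz : ‖z‖ < 1)

/-- The joint eigenvector at the point `z / ‖b‖ • b`, where `b` is the point of the
character `χ`. -/
def discVec : X.Fock :=
  ⟨X.discFun χ z, memℓp_gen (by
    simp only [X.norm_discFun χ z h, ENNReal.toReal_ofNat, Real.rpow_ofNat]
    simp_rw [← pow_mul, mul_comm _ 2, pow_mul]
    exact summable_geometric_of_lt_one (by positivity) (by nlinarith [norm_nonneg z]))⟩

theorem hasSum_inner_discVec (f : X.Fock) :
    HasSum (fun n => (z / ‖X.point χ‖) ^ n * inner ℂ (X.homPoint χ n) (f n))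
      (inner ℂ (X.discVec h hz) f) := by
  simp_rw [← inner_discFun]
  exact lp.hasSum_inner (𝕜 := ℂ) (X.discVec h hz) f

theorem inner_discVec_vacuum : inner ℂ (X.discVec h hz) X.vacuum = (1 : ℂ) := by
  rw [vacuum, lp.inner_single_right]
  change inner ℂ (X.discFun χ z 0) _ = (1 : ℂ)
  rw [inner_discFun, inner_homPoint_zero]
  simp

/-- The shift has no degree-zero part, and each later term splits off the same scalar factor. -/
theorem inner_discVec_shift (x : X.fiber 1) (f : X.Fock) :
    inner ℂ (X.discVec h hz) (X.shift x f) =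
      (z / ‖X.point χ‖ * inner ℂ (X.point χ) x) * inner ℂ (X.discVec h hz) f := by
  have h1 := (X.hasSum_inner_discVec h hz f).mul_left (z / ‖X.point χ‖ * inner ℂ (X.point χ) x)
  have h2 := (hasSum_nat_add_iff' 1).2 (X.hasSum_inner_discVec h hz (X.shift x f))
  simp only [Finset.range_one, Finset.sum_singleton, shift_apply_zero, inner_zero_right,
    mul_zero, sub_zero, shift_apply_succ, inner_homPoint_succ] at h2
  refine h2.unique ?_
  rw [show (fun n => (z / ‖X.point χ‖) ^ (n + 1) *
      (inner ℂ (X.point χ) x * inner ℂ (X.homPoint χ n) (f n))) = _ from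
      funext fun n => by rw [pow_succ', mul_mul_mul_comm]]
  exact h1

/-- Every nonvacuum character lies on a holomorphic disc of characters centred at the vacuum
state. -/
theorem exists_disc (χ : X.tensorAlgebra →ₐ[ℂ] ℂ) (h : X.point χ ≠ 0) :
    ∃ D : ℂ → (X.tensorAlgebra →ₐ[ℂ] ℂ),
    (∀ z, ‖z‖ < 1 → ∀ x, D z (X.gen x) = z / ‖X.point χ‖ * inner ℂ (X.point χ) x) ∧
    ∀ T, DifferentiableOn ℂ (fun z => D z T) (Metric.ball 0 1) := by
  classical
  let D : ℂ → (X.tensorAlgebra →ₐ[ℂ] ℂ) := fun z => if hz : ‖z‖ < 1 then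
    X.eigenCharacter (X.discVec h hz) (X.inner_discVec_vacuum h hz) _
      (X.inner_discVec_shift h hz) else X.vacuumState
  have hD : ∀ z (hz : ‖z‖ < 1), D z = X.eigenCharacter (X.discVec h hz)
      (X.inner_discVec_vacuum h hz) _ (X.inner_discVec_shift h hz) := fun z hz => dif_pos hz
  refine ⟨D, fun z hz x => by rw [hD z hz, eigenCharacter_gen], fun T z₀ hz₀ => ?_⟩
  rw [mem_ball_zero_iff] at hz₀
  -- On the ball of radius ρ < 1 the series has the summable majorant ρⁿ‖f‖.
  obtain ⟨ρ, h1, h2⟩ := exists_between hz₀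
  have hρ : 0 ≤ ρ := (norm_nonneg _).trans h1.le
  set f : X.Fock := (T : X.Fock →L[ℂ] X.Fock) X.vacuum
  have hd : DifferentiableOn ℂ
      (fun z : ℂ => ∑' n, (z / ‖X.point χ‖) ^ n * inner ℂ (X.homPoint χ n) (f n))
      (Metric.ball 0 ρ) := by
    refine Complex.differentiableOn_tsum_of_summable_norm (u := fun n => ρ ^ n * ‖f‖)
      ((summable_geometric_of_lt_one hρ h2).mul_right _)
      (fun n => by fun_prop) Metric.isOpen_ball fun n z hz => ?_
    rw [mem_ball_zero_iff] at hz
    rw [← inner_discFun]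
    refine (norm_inner_le_norm _ _).trans ?_
    rw [X.norm_discFun χ z h]
    exact mul_le_mul (pow_le_pow_left₀ (norm_nonneg _) hz.le n)
      (lp.norm_apply_le_norm (by norm_num) f n) (norm_nonneg _) (by positivity)
  have hd' : DifferentiableOn ℂ (fun z => D z T) (Metric.ball 0 ρ) := by
    refine hd.congr fun z hz => ?_
    rw [mem_ball_zero_iff] at hz
    rw [hD z (hz.trans h2), eigenCharacter_apply]
    exact (X.hasSum_inner_discVec h (hz.trans h2) f).tsum_eq.symm
  exact (hd'.differentiableAt (Metric.isOpen_ball.mem_nhds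
    (mem_ball_zero_iff.2 h1))).differentiableWithinAt

end Disc

end SubproductSystem

/-! ### Complete boundedness and ⋆-homomorphisms. -/

theorem StarAlgEquiv.isometry_of_cstarAlgebra {A B : Type*} [CStarAlgebra A] [CStarAlgebra B]
    (σ : A ≃⋆ₐ[ℂ] B) : Isometry σ :=
  NonUnitalStarAlgHom.isometry σ σ.injective

/-- A ⋆-isomorphism of C⋆-algebras as a non-unital ⋆-homomorphism. -/
def StarAlgEquiv.toNonUnitalStarAlgHomOfCStar {A B : Type*} [CStarAlgebra A] [CStarAlgebra B]
    (σ : A ≃⋆ₐ[ℂ] B) : A →⋆ₙₐ[ℂ] B :=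
  NonUnitalStarAlgHomClass.toNonUnitalStarAlgHom σ

section CompletelyBounded

variable {H K L : Type*} [NormedAddCommGroup H] [InnerProductSpace ℂ H] [CompleteSpace H]
  [NormedAddCommGroup K] [InnerProductSpace ℂ K] [CompleteSpace K]
  [NormedAddCommGroup L] [InnerProductSpace ℂ L] [CompleteSpace L]
  {A : Subalgebra ℂ (H →L[ℂ] H)} {B : Subalgebra ℂ (K →L[ℂ] K)} {C : Subalgebra ℂ (L →L[ℂ] L)}

theorem IsCompletelyBounded.comp {ψ : B →ₗ[ℂ] C} {φ : A →ₗ[ℂ] B} (hψ : IsCompletelyBounded ψ)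
    (hφ : IsCompletelyBounded φ) : IsCompletelyBounded (ψ ∘ₗ φ) := by
  obtain ⟨c, hc⟩ := hψ
  obtain ⟨d, hd⟩ := hφ
  refine ⟨|c| * d, fun n a => ?_⟩
  calc _ ≤ c * ‖CStarMatrix.ofMatrix ((a.map φ).map fun x => (x : K →L[ℂ] K))‖ := hc n (a.map φ)
    _ ≤ |c| * ‖CStarMatrix.ofMatrix ((a.map φ).map fun x => (x : K →L[ℂ] K))‖ :=
      mul_le_mul_of_nonneg_right (le_abs_self c) (norm_nonneg _)
    _ ≤ |c| * (d * ‖CStarMatrix.ofMatrix (a.map fun x => (x : H →L[ℂ] H))‖) :=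
      mul_le_mul_of_nonneg_left (hd n a) (abs_nonneg c)
    _ = _ := (mul_assoc _ _ _).symm

/-- Applied entrywise to matrices, σ is again a ⋆-homomorphism of C⋆-algebras, hence contractive;
the constant is 1 at every matrix size. -/
theorem isCompletelyBounded_of_starAlgHom (σ : (H →L[ℂ] H) →⋆ₙₐ[ℂ] (K →L[ℂ] K)) (φ : A →ₗ[ℂ] B)
    (h : ∀ T : A, (φ T : K →L[ℂ] K) = σ T) : IsCompletelyBounded φ := by
  refine ⟨1, fun n a => ?_⟩
  rw [one_mul]
  have h1 : CStarMatrix.ofMatrix (a.map fun x => (φ x : K →L[ℂ] K)) =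
      CStarMatrix.mapₙₐ σ (CStarMatrix.ofMatrix (a.map fun x => (x : H →L[ℂ] H))) := by
    exact CStarMatrix.ext fun i j => h (a i j)
  rw [h1]
  exact NonUnitalStarAlgHom.norm_apply_le _ _

theorem isCompletelyBounded_of_starAlgEquiv (σ : (H →L[ℂ] H) ≃⋆ₐ[ℂ] (K →L[ℂ] K))
    (φ : A →ₗ[ℂ] B) (h : ∀ T : A, (φ T : K →L[ℂ] K) = σ T) : IsCompletelyBounded φ :=
  isCompletelyBounded_of_starAlgHom σ.toNonUnitalStarAlgHomOfCStar φ h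

theorem isometry_of_starAlgEquiv (σ : (H →L[ℂ] H) ≃⋆ₐ[ℂ] (K →L[ℂ] K))
    (φ : A →ₗ[ℂ] B) (h : ∀ T : A, (φ T : K →L[ℂ] K) = σ T) : Isometry φ :=
  Isometry.of_dist_eq fun T U => by
    rw [Subtype.dist_eq, Subtype.dist_eq, h, h]
    exact σ.isometry_of_cstarAlgebra.dist_eq _ _

end CompletelyBounded

/-! ### Gauge automorphisms. -/

namespace SubproductSystem

variable (X : SubproductSystem)

/-- The diagonal unitary `⨁ uⁿ` on the Fock space. -/
def gaugeOp (u : Circle) : X.Fock →L[ℂ] X.Fock :=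
  LinearMap.mkContinuous
    { toFun := fun f => ⟨fun n => (u : ℂ) ^ n • f n, memℓp_gen (by
        simpa [norm_smul, Circle.norm_coe] using (X.hasSum_sq f).summable)⟩
      map_add' := fun f g => by
        ext n
        exact smul_add ((u : ℂ) ^ n) (f n) (g n)
      map_smul' := fun c f => by
        ext n
        exact smul_comm ((u : ℂ) ^ n) c (f n) }
    1 (fun f => by
      refine lp.norm_le_of_tsum_le (by norm_num) (by positivity) ?_
      simpa [norm_smul, Circle.norm_coe] using (X.hasSum_sq f).tsum_eq.le)

theorem gaugeOp_apply (u : Circle) (f : X.Fock) (n : ℕ) :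
    X.gaugeOp u f n = (u : ℂ) ^ n • f n := rfl

theorem gaugeOp_one : X.gaugeOp 1 = 1 := by
  ext f n
  rw [gaugeOp_apply]
  simp

theorem gaugeOp_mul (u v : Circle) : X.gaugeOp u * X.gaugeOp v = X.gaugeOp (u * v) := by
  ext f n
  change X.gaugeOp u (X.gaugeOp v f) n = _
  rw [gaugeOp_apply, gaugeOp_apply, gaugeOp_apply, smul_smul, Circle.coe_mul, mul_pow]

theorem star_gaugeOp (u : Circle) : star (X.gaugeOp u) = X.gaugeOp u⁻¹ := by
  rw [ContinuousLinearMap.star_eq_adjoint, eq_comm, ContinuousLinearMap.eq_adjoint_iff]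
  intro f g
  rw [lp.inner_eq_tsum, lp.inner_eq_tsum]
  refine tsum_congr fun n => ?_
  rw [gaugeOp_apply, gaugeOp_apply, inner_smul_left, inner_smul_right, map_pow,
    Circle.coe_inv_eq_conj, Complex.conj_conj]

/-- The diagonal unitary `⨁ uⁿ` as an element of the unitary group. -/
def gaugeUnitary (u : Circle) : unitary (X.Fock →L[ℂ] X.Fock) :=
  ⟨X.gaugeOp u, by
    rw [Unitary.mem_iff, star_gaugeOp, gaugeOp_mul, gaugeOp_mul, inv_mul_cancel, mul_inv_cancel,
      gaugeOp_one]
    exact ⟨rfl, rfl⟩⟩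

/-- The gauge automorphism of the algebra of all operators on the Fock space. -/
def gaugeStar (u : Circle) : (X.Fock →L[ℂ] X.Fock) ≃⋆ₐ[ℂ] (X.Fock →L[ℂ] X.Fock) :=
  Unitary.conjStarAlgAut ℂ _ (X.gaugeUnitary u)

theorem gaugeStar_apply (u : Circle) (T : X.Fock →L[ℂ] X.Fock) :
    X.gaugeStar u T = X.gaugeOp u * T * X.gaugeOp u⁻¹ := by
  rw [← star_gaugeOp]
  rfl

theorem gaugeStar_gaugeStar_inv (u : Circle) (T : X.Fock →L[ℂ] X.Fock) :
    X.gaugeStar u (X.gaugeStar u⁻¹ T) = T := by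
  rw [gaugeStar_apply, gaugeStar_apply, inv_inv, ← mul_assoc, ← mul_assoc, gaugeOp_mul,
    mul_assoc, gaugeOp_mul, mul_inv_cancel, gaugeOp_one, one_mul, mul_one]

theorem gaugeStar_shift (u : Circle) (x : X.fiber 1) :
    X.gaugeStar u (X.shift x) = (u : ℂ) • X.shift x := by
  have h : X.gaugeOp u * X.shift x = ((u : ℂ) • X.shift x) * X.gaugeOp u := by
    ext f n
    change X.gaugeOp u (X.shift x f) n = (u : ℂ) • X.shift x (X.gaugeOp u f) n
    rw [gaugeOp_apply]
    cases n with
    | zero => simp [shift_apply_zero]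
    | succ n =>
      rw [shift_apply_succ, shift_apply_succ, gaugeOp_apply, HilbertTensor.proj_smul, smul_smul,
        pow_succ']
  rw [gaugeStar_apply, h, mul_assoc, gaugeOp_mul, mul_inv_cancel, gaugeOp_one, mul_one]

theorem gaugeStar_mem (u : Circle) {T : X.Fock →L[ℂ] X.Fock} (hT : T ∈ X.tensorAlgebra) :
    X.gaugeStar u T ∈ X.tensorAlgebra := by
  have hc : Continuous (X.gaugeStar u) := by
    simp_rw [funext (X.gaugeStar_apply u)]
    fun_prop
  have h : X.tensorAlgebra ≤
      X.tensorAlgebra.comap (X.gaugeStar u).toAlgEquiv.toAlgHom := by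
    refine Subalgebra.topologicalClosure_minimal (Algebra.adjoin_le ?_)
      (X.isClosed_tensorAlgebra.preimage hc)
    rintro _ ⟨x, rfl⟩
    change X.gaugeStar u (X.shift x) ∈ X.tensorAlgebra
    rw [gaugeStar_shift]
    exact X.tensorAlgebra.smul_mem (X.shift_mem x) _
  exact h hT

/-- The gauge automorphism `S(x) ↦ u S(x)` of the tensor algebra. -/
def gauge (u : Circle) : X.tensorAlgebra ≃ₐ[ℂ] X.tensorAlgebra where
  toFun T := ⟨X.gaugeStar u T, X.gaugeStar_mem u T.2⟩
  invFun T := ⟨X.gaugeStar u⁻¹ T, X.gaugeStar_mem u⁻¹ T.2⟩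
  left_inv T := Subtype.ext (by simpa using X.gaugeStar_gaugeStar_inv u⁻¹ T)
  right_inv T := Subtype.ext (X.gaugeStar_gaugeStar_inv u T)
  map_mul' T U := Subtype.ext ((X.gaugeStar u).toAlgEquiv.map_mul (T : X.Fock →L[ℂ] X.Fock) U)
  map_add' T U := Subtype.ext ((X.gaugeStar u).toAlgEquiv.map_add (T : X.Fock →L[ℂ] X.Fock) U)
  commutes' c := Subtype.ext ((X.gaugeStar u).toAlgEquiv.commutes c)

theorem coe_gauge_apply (u : Circle) (T : X.tensorAlgebra) :
    (X.gauge u T : X.Fock →L[ℂ] X.Fock) = X.gaugeStar u T := rfl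

theorem gauge_symm (u : Circle) : (X.gauge u).symm = X.gauge u⁻¹ := AlgEquiv.ext fun _ => rfl

theorem gauge_gen (u : Circle) (x : X.fiber 1) : X.gauge u (X.gen x) = (u : ℂ) • X.gen x :=
  Subtype.ext (X.gaugeStar_shift u x)

theorem isometry_gauge (u : Circle) : Isometry (X.gauge u) :=
  isometry_of_starAlgEquiv (X.gaugeStar u) (X.gauge u).toLinearMap fun _ => rfl

theorem isCompletelyBounded_gauge (u : Circle) :
    IsCompletelyBounded (X.gauge u).toLinearMap :=
  isCompletelyBounded_of_starAlgEquiv (X.gaugeStar u) _ fun _ => rfl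

end SubproductSystem

/-! ### Cauchy-Schwarz equality and the Möbius involution of the disc. -/

/-- In an inner product space, two vectors whose inner product is extremal for the
Cauchy-Schwarz inequality are equal. -/
theorem eq_of_inner_eq_norm_sq {E : Type*} [NormedAddCommGroup E] [InnerProductSpace ℂ E]
    {p q : E} (hp : ‖p‖ ≤ ‖q‖) (h : inner ℂ p q = ((‖q‖ ^ 2 : ℝ) : ℂ)) : p = q := by
  have h1 := norm_sub_sq (𝕜 := ℂ) p q
  rw [h, RCLike.re_to_complex, Complex.ofReal_re] at h1
  have h2 : ‖p - q‖ ^ 2 ≤ 0 := by nlinarith [norm_nonneg p, norm_nonneg q]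
  rw [← sub_eq_zero, ← norm_eq_zero]
  exact pow_eq_zero_iff (two_ne_zero) |>.1 (le_antisymm h2 (sq_nonneg _))

/-- The involutive disc automorphism exchanging `0` and `r`. -/
def discInvolution (r : ℝ) (z : ℂ) : ℂ := (r - z) / (1 - r * z)

section Involution

variable {r : ℝ} (hr0 : 0 ≤ r) (hr : r < 1)
include hr0 hr

theorem one_sub_mul_ne_zero {z : ℂ} (hz : ‖z‖ ≤ 1) : (1 - r * z : ℂ) ≠ 0 := by
  intro h
  have h1 : (r * z : ℂ) = 1 := (sub_eq_zero.1 h).symm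
  have h2 : r * ‖z‖ = 1 := by
    have := congrArg norm h1
    rwa [norm_mul, Complex.norm_real, Real.norm_of_nonneg hr0, norm_one] at this
  nlinarith

theorem norm_discInvolution_lt {z : ℂ} (hz : ‖z‖ < 1) : ‖discInvolution r z‖ < 1 := by
  have h0 := one_sub_mul_ne_zero hr0 hr hz.le
  rw [discInvolution, norm_div, div_lt_one (norm_pos_iff.2 h0)]
  refine lt_of_pow_lt_pow_left₀ 2 (norm_nonneg _) ?_
  have hz2 : z.re * z.re + z.im * z.im < 1 := by
    rw [← Complex.normSq_apply, Complex.normSq_eq_norm_sq]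
    nlinarith [norm_nonneg z]
  rw [← Complex.normSq_eq_norm_sq, ← Complex.normSq_eq_norm_sq, Complex.normSq_apply,
    Complex.normSq_apply]
  simp
  -- This rests on |1 - rz|² - |r - z|² = (1 - r²)(1 - |z|²).
  nlinarith [mul_pos (sub_pos.2 hz2) (show 0 < 1 - r ^ 2 by nlinarith)]

theorem differentiableOn_discInvolution :
    DifferentiableOn ℂ (discInvolution r) (Metric.ball 0 1) := by
  intro z hz
  have h0 := one_sub_mul_ne_zero hr0 hr (mem_ball_zero_iff.1 hz).le
  unfold discInvolution
  fun_prop (disch := assumption)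

/-- The circle of radius r meets its image under the involution; the two rotations used to correct φ
come from such a meeting point. -/
theorem exists_discInvolution_eq :
    ∃ u v : Circle, discInvolution r (r * v) = r * u := by
  -- The requirement |1 - v| = |1 - r²v| for unimodular v reads 2(1 - r²) Re v = 1 - r⁴, whence this
  -- value of Re v.
  set c : ℝ := (1 + r ^ 2) / 2 with hc
  have hr2 : r ^ 2 ≤ 1 := by nlinarith
  have hc1 : c ^ 2 ≤ 1 := pow_le_one₀ (by positivity) (by linarith)
  set d : ℝ := √(1 - c ^ 2)
  have hd : d ^ 2 = 1 - c ^ 2 := Real.sq_sqrt (by linarith)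
  have hv : ‖(⟨c, d⟩ : ℂ)‖ = 1 := by
    rw [← sq_eq_sq₀ (norm_nonneg _) zero_le_one, ← Complex.normSq_eq_norm_sq,
      Complex.normSq_apply]
    simp only
    nlinarith
  set v : ℂ := ⟨c, d⟩
  have h0 : (1 - r * (r * v) : ℂ) ≠ 0 := by
    refine one_sub_mul_ne_zero hr0 hr ?_
    rw [norm_mul, hv, Complex.norm_real, Real.norm_of_nonneg hr0]
    linarith
  have hu : ‖(1 - v) / (1 - r * (r * v))‖ = 1 := by
    rw [norm_div, div_eq_one_iff_eq (norm_ne_zero_iff.2 h0),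
      ← sq_eq_sq₀ (norm_nonneg _) (norm_nonneg _), ← Complex.normSq_eq_norm_sq,
      ← Complex.normSq_eq_norm_sq, Complex.normSq_apply, Complex.normSq_apply]
    simp [v]
    have e : r ^ 2 = 2 * c - 1 := by rw [hc]; ring
    linear_combination (1 - r ^ 4) * hd + (r ^ 2 * 2 * c - (r ^ 2 + 2 * c - 1)) * e
  refine ⟨⟨_, mem_sphere_zero_iff_norm.2 hu⟩, ⟨v, mem_sphere_zero_iff_norm.2 hv⟩, ?_⟩
  change (r - r * v) / (1 - r * (r * v)) = r * ((1 - v) / (1 - r * (r * v)))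
  ring

end Involution

namespace SubproductSystem

/-! ### Schwarz lemma and maximum principle for discs of characters. -/

section Schwarz

variable {X : SubproductSystem} {F : ℂ → (X.tensorAlgebra →ₐ[ℂ] ℂ)}
  (hF : ∀ x, DifferentiableOn ℂ (fun z => F z (X.gen x)) (Metric.ball 0 1))

section Vacuum

variable (h0 : F 0 = X.vacuumState)
include hF h0

/-- With p the point of F z, the scalar function w ↦ F w (S(p)) vanishes at 0, is bounded by ‖p‖ and
equals ‖p‖² at z; the Schwarz lemma gives ‖p‖² ≤ ‖p‖ |z|. -/
theorem norm_point_le_norm {z : ℂ} (hz : ‖z‖ < 1) : ‖X.point (F z)‖ ≤ ‖z‖ := by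
  set p := X.point (F z) with hp
  have h1 := Complex.dist_le_div_mul_dist_of_mapsTo_ball (R₂ := ‖p‖) (hF p)
    (fun w _ => by
      rw [h0, vacuumState_gen, mem_closedBall_zero_iff]
      exact X.norm_character_gen_le _ _) (mem_ball_zero_iff.2 hz)
  rw [h0, vacuumState_gen, dist_zero_right, dist_zero_right, ← inner_point, ← hp,
    inner_self_eq_norm_sq_to_K, div_one] at h1
  simp only [norm_pow, Complex.coe_algebraMap, Complex.norm_real, norm_norm] at h1
  by_contra! h
  nlinarith [norm_nonneg z]

/-- Equality in the Schwarz estimate at a single point forces the whole disc to be linear. -/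
theorem apply_gen_of_norm_point_eq {r : ℝ} (hr0 : 0 < r) (hr : r < 1)
    (hFr : ‖X.point (F r)‖ = r) {z : ℂ} (hz : ‖z‖ < 1) (x : X.fiber 1) :
    F z (X.gen x) = z / r * F r (X.gen x) := by
  have hrC : (r : ℂ) ≠ 0 := Complex.ofReal_ne_zero.2 hr0.ne'
  set b := X.point (F r) with hb
  have hrb : F r (X.gen b) = r * r := by
    rw [← inner_point, ← hb, inner_self_eq_norm_sq_to_K, hFr, pow_two]; rfl
  have hrball : (r : ℂ) ∈ Metric.ball (0 : ℂ) 1 := by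
    rw [mem_ball_zero_iff, Complex.norm_real, Real.norm_of_nonneg hr0.le]; exact hr
  have h00 : F 0 (X.gen b) = 0 := by rw [h0, vacuumState_gen]
  -- The function w ↦ F w (S(b)) is bounded by r and has slope r²/r = r between 0 and r, the extreme
  -- value.
  have h1 := Complex.affine_of_mapsTo_ball_of_norm_dslope_eq_div (R₂ := r) (hF b)
    (fun w _ => by
      rw [h00, mem_closedBall_zero_iff]
      exact (X.norm_character_gen_le _ _).trans hFr.le) hrball (by
      rw [dslope_of_ne _ hrC, slope_def_field, h00, hrb]
      simp [hr0.le, hr0.ne'])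
  have h2 : F z (X.gen b) = z * r := by
    have := h1 (mem_ball_zero_iff.2 hz)
    rw [dslope_of_ne _ hrC, slope_def_field] at this
    simp only [h00, hrb, sub_zero, zero_add, smul_eq_mul] at this
    rw [this]
    field_simp
  -- The pairing with b is known and the norm is at most |z|, so equality in Cauchy-Schwarz fixes
  -- the vector, not just its b-component.
  have h3 : X.point (F z) = (starRingEnd ℂ z / r) • b := by
    have hn : ‖(starRingEnd ℂ z / r) • b‖ = ‖z‖ := by
      rw [norm_smul, hFr, norm_div, Complex.norm_real, Real.norm_of_nonneg hr0.le,
        RCLike.norm_conj]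
      field_simp
    refine eq_of_inner_eq_norm_sq ?_ ?_
    · rw [hn]
      exact norm_point_le_norm hF h0 hz
    · rw [hn, inner_smul_right, inner_point, h2, Complex.ofReal_pow, ← Complex.conj_mul']
      field_simp
  rw [← inner_point, h3, inner_smul_left, hb, inner_point]
  simp

end Vacuum

include hF in
-- With b the point of F 0, w ↦ F w (S(b)) attains its maximum modulus 1 at the centre, hence is
-- constant; equality in Cauchy-Schwarz then recovers the character.
theorem eq_of_norm_point_eq_one (h0 : ‖X.point (F 0)‖ = 1) {z : ℂ} (hz : ‖z‖ < 1) :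
    F z = F 0 := by
  set b := X.point (F 0) with hb
  have h00 : F 0 (X.gen b) = 1 := by
    rw [← inner_point, ← hb, inner_self_eq_norm_sq_to_K, h0]; simp
  have h1 := Complex.eqOn_of_isPreconnected_of_isMaxOn_norm
    (convex_ball (0 : ℂ) 1).isPreconnected Metric.isOpen_ball (hF b)
    (Metric.mem_ball_self one_pos) (fun w _ => by
      change ‖F w (X.gen b)‖ ≤ ‖F 0 (X.gen b)‖
      rw [h00, norm_one, ← h0]
      exact X.norm_character_gen_le _ _)
  have h2 : F z (X.gen b) = 1 := (h1 (mem_ball_zero_iff.2 hz)).trans h00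
  have h3 : X.point (F z) = b := by
    refine eq_of_inner_eq_norm_sq ?_ ?_
    · rw [h0]
      exact X.norm_point_le_one _
    · rw [inner_point, h2, h0]
      simp
  refine X.character_ext fun x => ?_
  rw [← inner_point, h3, hb, inner_point]

end Schwarz

/-! ### Pulling discs back along an isomorphism and correcting by rotations. -/

section Isomorphism

universe u v

/-- The pullback of the vacuum state under an isomorphism. -/
abbrev vacuumPullback {X : SubproductSystem.{u}} {Y : SubproductSystem.{v}}
    (φ : X.tensorAlgebra ≃ₐ[ℂ] Y.tensorAlgebra) : X.tensorAlgebra →ₐ[ℂ] ℂ :=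
  Y.vacuumState.comp φ.toAlgHom

variable {X : SubproductSystem.{u}} {Y : SubproductSystem.{v}}
  (φ : X.tensorAlgebra ≃ₐ[ℂ] Y.tensorAlgebra)

theorem vacuumPullback_apply (T : X.tensorAlgebra) :
    vacuumPullback φ T = Y.vacuumState (φ T) := rfl

theorem vacuumPullback_symm_ne (h : vacuumPullback φ ≠ X.vacuumState) :
    vacuumPullback φ.symm ≠ Y.vacuumState := by
  contrapose! h
  ext T
  rw [vacuumPullback_apply, ← h, vacuumPullback_apply, AlgEquiv.symm_apply_apply]

theorem eq_vacuumState_of_apply_gen_zero {Z : SubproductSystem} {χ : Z.tensorAlgebra →ₐ[ℂ] ℂ}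
    (h : ∀ x, χ (Z.gen x) = 0) : χ = Z.vacuumState :=
  Z.character_ext fun x => by rw [h, vacuumState_gen]

/-- Otherwise the maximum principle makes the pullback by φ of a nonconstant disc of `Y` constant,
contradicting bijectivity of φ. -/
theorem norm_point_vacuumPullback_lt (h : vacuumPullback φ ≠ X.vacuumState) :
    ‖X.point (vacuumPullback φ)‖ < 1 := by
  refine lt_of_le_of_ne (X.norm_point_le_one _) fun h1 => ?_
  have ha := Y.point_ne_zero (vacuumPullback_symm_ne φ h)
  obtain ⟨D, hD, hDd⟩ := Y.exists_disc _ ha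
  have hD0 : D 0 = Y.vacuumState := eq_vacuumState_of_apply_gen_zero fun x => by
    rw [hD 0 (by simp)]; simp
  have h2 : ‖(1 / 2 : ℂ)‖ < 1 := by norm_num
  have h3 := eq_of_norm_point_eq_one (F := fun z => (D z).comp φ.toAlgHom)
    (fun x => hDd (φ (X.gen x))) (by rw [hD0]; exact h1) h2
  have h4 : D (1 / 2) = D 0 := by
    ext T
    have := DFunLike.congr_fun h3 (φ.symm T)
    change D (1 / 2) (φ (φ.symm T)) = D 0 (φ (φ.symm T)) at this
    rwa [AlgEquiv.apply_symm_apply] at this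
  have h5 := hD _ h2 (Y.point (vacuumPullback φ.symm))
  rw [h4, hD0, vacuumState_gen, inner_self_eq_norm_sq_to_K] at h5
  simp [ha] at h5

/-- The involution recentres the pulled-back disc: in `Y` the vacuum sits at 0 and the pullback of
the vacuum of `X` at s. Points s·u of the disc of `Y` are gauge rotations of the latter, which gives
the last clause. -/
theorem exists_pullback_disc (h : vacuumPullback φ ≠ X.vacuumState) {s : ℝ}
    (hs : ‖Y.point (vacuumPullback φ.symm)‖ = s) :
    ∃ F : ℂ → (X.tensorAlgebra →ₐ[ℂ] ℂ),
      (∀ x, DifferentiableOn ℂ (fun z => F z (X.gen x)) (Metric.ball 0 1)) ∧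
      F 0 = X.vacuumState ∧ F s = vacuumPullback φ ∧
      ∀ (z : ℂ) (u : Circle), discInvolution s z = s * u → ∀ T,
        F z T = X.vacuumState (φ.symm (Y.gauge u (φ T))) := by
  have ha := Y.point_ne_zero (vacuumPullback_symm_ne φ h)
  have hs1 : s < 1 := by
    rw [← hs]
    exact norm_point_vacuumPullback_lt φ.symm (vacuumPullback_symm_ne φ h)
  have hs0 : 0 < s := by rw [← hs]; exact norm_pos_iff.2 ha
  have hsC : (s : ℂ) ≠ 0 := Complex.ofReal_ne_zero.2 hs0.ne'
  have hsn : ‖(s : ℂ)‖ < 1 := by rwa [Complex.norm_real, Real.norm_of_nonneg hs0.le]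
  obtain ⟨D, hD, hDd⟩ := Y.exists_disc _ ha
  simp only [hs] at hD
  have hD0 : D 0 = Y.vacuumState := eq_vacuumState_of_apply_gen_zero fun x => by
    rw [hD 0 (by simp)]; simp
  have hu : ∀ u : Circle, D (s * u) =
      (vacuumPullback φ.symm).comp (Y.gauge u).toAlgHom := fun u => by
    refine Y.character_ext fun y => ?_
    rw [hD _ (by rwa [norm_mul, Circle.norm_coe, mul_one]), inner_point]
    change _ = vacuumPullback φ.symm (Y.gauge u (Y.gen y))
    rw [gauge_gen, ← AlgHom.toLinearMap_apply _ ((u : ℂ) • _), LinearMap.map_smul,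
      AlgHom.toLinearMap_apply, mul_div_cancel_left₀ _ hsC, smul_eq_mul]
  have hDs : D s = vacuumPullback φ.symm := by
    refine Y.character_ext fun y => ?_
    rw [hD _ hsn, inner_point, div_self hsC, one_mul]
  refine ⟨fun z => (D (discInvolution s z)).comp φ.toAlgHom, fun x => ?_, ?_, ?_, ?_⟩
  · exact (hDd (φ (X.gen x))).comp (differentiableOn_discInvolution hs0.le hs1) fun z hz =>
      mem_ball_zero_iff.2 (norm_discInvolution_lt hs0.le hs1 (mem_ball_zero_iff.1 hz))
  · have : discInvolution s 0 = s := by simp [discInvolution]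
    simp only [this, hDs]
    ext T
    change X.vacuumState (φ.symm (φ T)) = _
    rw [AlgEquiv.symm_apply_apply]
  · have : discInvolution s s = 0 := by simp [discInvolution]
    simp only [this, hD0]
  · intro z u hzu T
    simp only [hzu, hu]
    rfl

theorem norm_point_vacuumPullback_le (h : vacuumPullback φ ≠ X.vacuumState) :
    ‖X.point (vacuumPullback φ)‖ ≤ ‖Y.point (vacuumPullback φ.symm)‖ := by
  obtain ⟨F, hF, h0, h1, -⟩ := exists_pullback_disc φ h rfl
  have h2 := norm_point_le_norm hF h0 (z := ‖Y.point (vacuumPullback φ.symm)‖) (by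
    rw [Complex.norm_real, norm_norm]
    exact norm_point_vacuumPullback_lt φ.symm (vacuumPullback_symm_ne φ h))
  rwa [h1, Complex.norm_real, norm_norm] at h2

theorem exists_gauge_intertwining : ∃ u v : Circle, ∀ T,
    X.vacuumState (φ.symm (Y.gauge u (φ T))) = Y.vacuumState (φ (X.gauge v T)) := by
  by_cases h : vacuumPullback φ = X.vacuumState
  · refine ⟨1, 1, fun T => ?_⟩
    have h1 : ∀ (Z : SubproductSystem.{u}) (U : Z.tensorAlgebra), Z.gauge 1 U = U := fun Z U =>
      Subtype.ext (by
        rw [coe_gauge_apply, gaugeStar_apply, inv_one, gaugeOp_one, one_mul, mul_one])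
    have h2 : ∀ (Z : SubproductSystem.{v}) (U : Z.tensorAlgebra), Z.gauge 1 U = U := fun Z U =>
      Subtype.ext (by
        rw [coe_gauge_apply, gaugeStar_apply, inv_one, gaugeOp_one, one_mul, mul_one])
    rw [h1, h2, AlgEquiv.symm_apply_apply, ← h]
    rfl
  set r := ‖X.point (vacuumPullback φ)‖ with hr
  have hr0 : 0 < r := norm_pos_iff.2 (X.point_ne_zero h)
  have hr1 : r < 1 := norm_point_vacuumPullback_lt φ h
  -- The Schwarz estimate for φ and for φ⁻¹ together give equality, which makes F linear.
  have hs : ‖Y.point (vacuumPullback φ.symm)‖ = r :=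
    le_antisymm (norm_point_vacuumPullback_le φ.symm (vacuumPullback_symm_ne φ h))
      (norm_point_vacuumPullback_le φ h)
  obtain ⟨F, hF, h0, h1, h2⟩ := exists_pullback_disc φ h hs
  obtain ⟨u, v, huv⟩ := exists_discInvolution_eq hr0.le hr1
  have hv : ‖(r * v : ℂ)‖ < 1 := by
    rwa [norm_mul, Circle.norm_coe, mul_one, Complex.norm_real, Real.norm_of_nonneg hr0.le]
  -- Linearity turns multiplication of the parameter r by v into the gauge rotation by v; the same
  -- character is computed on the `Y` side through u.
  have hF' : F (r * v) = (vacuumPullback φ).comp (X.gauge v).toAlgHom := by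
    refine X.character_ext fun x => ?_
    rw [apply_gen_of_norm_point_eq hF h0 hr0 hr1 (by rw [h1]) hv, h1,
      mul_div_cancel_left₀ _ (Complex.ofReal_ne_zero.2 hr0.ne')]
    change _ = vacuumPullback φ (X.gauge v (X.gen x))
    rw [gauge_gen, ← AlgHom.toLinearMap_apply _ ((v : ℂ) • _), LinearMap.map_smul,
      AlgHom.toLinearMap_apply, smul_eq_mul]
  refine ⟨u, v, fun T => ?_⟩
  rw [← h2 _ u huv T, hF']
  rfl

/-- The isomorphism `φ ∘ γ_v ∘ φ⁻¹ ∘ γ_u⁻¹ ∘ φ`. -/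
def gaugeTwist (u v : Circle) : X.tensorAlgebra ≃ₐ[ℂ] Y.tensorAlgebra :=
  (((φ.trans (Y.gauge u⁻¹)).trans φ.symm).trans (X.gauge v)).trans φ

theorem exists_vacuumPreserving_gaugeTwist : ∃ u v : Circle,
    VacuumPreserving (gaugeTwist φ u v) := by
  obtain ⟨u, v, h⟩ := exists_gauge_intertwining φ
  refine ⟨u, v, AlgHom.ext fun T => ?_⟩
  change Y.vacuumState (φ (X.gauge v (φ.symm (Y.gauge u⁻¹ (φ T))))) = _
  rw [← h, AlgEquiv.apply_symm_apply, ← gauge_symm, AlgEquiv.apply_symm_apply,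
    AlgEquiv.symm_apply_apply]

/-- The inverse has the same shape, so each regularity property need only be checked in the forward
direction. -/
theorem gaugeTwist_symm (u v : Circle) :
    (gaugeTwist φ u v).symm = gaugeTwist φ.symm v u := by
  refine AlgEquiv.ext fun T => ?_
  rw [AlgEquiv.symm_apply_eq]
  change T = φ (X.gauge v (φ.symm (Y.gauge u⁻¹ (φ
    (φ.symm (Y.gauge u (φ (X.gauge v⁻¹ (φ.symm T)))))))))
  rw [AlgEquiv.apply_symm_apply, ← gauge_symm, AlgEquiv.symm_apply_apply,
    AlgEquiv.symm_apply_apply, ← gauge_symm, AlgEquiv.apply_symm_apply, AlgEquiv.apply_symm_apply]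

variable {φ}

theorem continuous_gaugeTwist (h1 : Continuous φ) (h2 : Continuous φ.symm) (u v : Circle) :
    Continuous (gaugeTwist φ u v) :=
  h1.comp ((X.isometry_gauge v).continuous.comp (h2.comp
    ((Y.isometry_gauge u⁻¹).continuous.comp h1)))

theorem isometry_gaugeTwist (h1 : Isometry φ) (u v : Circle) : Isometry (gaugeTwist φ u v) :=
  have h2 : Isometry φ.symm := h1.right_inv φ.apply_symm_apply
  h1.comp ((X.isometry_gauge v).comp (h2.comp ((Y.isometry_gauge u⁻¹).comp h1)))

theorem isCompletelyBounded_gaugeTwist (h1 : IsCompletelyBounded φ.toLinearMap)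
    (h2 : IsCompletelyBounded φ.symm.toLinearMap) (u v : Circle) :
    IsCompletelyBounded (gaugeTwist φ u v).toLinearMap := by
  have h3 := h2.comp ((Y.isCompletelyBounded_gauge u⁻¹).comp h1)
  have h4 := h1.comp ((X.isCompletelyBounded_gauge v).comp h3)
  have h5 : (gaugeTwist φ u v).toLinearMap = φ.toLinearMap ∘ₗ (X.gauge v).toLinearMap ∘ₗ
      φ.symm.toLinearMap ∘ₗ (Y.gauge u⁻¹).toLinearMap ∘ₗ φ.toLinearMap :=
    LinearMap.ext fun _ => rfl
  rw [h5]
  exact h4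

end Isomorphism

end SubproductSystem

end

theorem mainTheorem5 (X Y : SubproductSystem) :
    (Nonempty (X.tensorAlgebra ≃ₐ[ℂ] Y.tensorAlgebra) →
      ∃ ψ : X.tensorAlgebra ≃ₐ[ℂ] Y.tensorAlgebra, SubproductSystem.VacuumPreserving ψ) ∧
    ((∃ φ : X.tensorAlgebra ≃ₐ[ℂ] Y.tensorAlgebra, Continuous φ ∧ Continuous φ.symm) →
      ∃ ψ : X.tensorAlgebra ≃ₐ[ℂ] Y.tensorAlgebra, Continuous ψ ∧ Continuous ψ.symm ∧
        SubproductSystem.VacuumPreserving ψ) ∧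
    ((∃ φ : X.tensorAlgebra ≃ₐ[ℂ] Y.tensorAlgebra, Isometry φ) →
      ∃ ψ : X.tensorAlgebra ≃ₐ[ℂ] Y.tensorAlgebra, Isometry ψ ∧
        SubproductSystem.VacuumPreserving ψ) ∧
    ((∃ φ : X.tensorAlgebra ≃ₐ[ℂ] Y.tensorAlgebra,
        IsCompletelyBounded φ.toLinearMap ∧ IsCompletelyBounded φ.symm.toLinearMap) →
      ∃ ψ : X.tensorAlgebra ≃ₐ[ℂ] Y.tensorAlgebra,
        IsCompletelyBounded ψ.toLinearMap ∧ IsCompletelyBounded ψ.symm.toLinearMap ∧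
        SubproductSystem.VacuumPreserving ψ) := by
  refine ⟨?_, ?_, ?_, ?_⟩
  · rintro ⟨φ⟩
    obtain ⟨u, v, h⟩ := SubproductSystem.exists_vacuumPreserving_gaugeTwist φ
    exact ⟨_, h⟩
  · rintro ⟨φ, h1, h2⟩
    obtain ⟨u, v, h⟩ := SubproductSystem.exists_vacuumPreserving_gaugeTwist φ
    refine ⟨_, SubproductSystem.continuous_gaugeTwist h1 h2 u v, ?_, h⟩
    rw [SubproductSystem.gaugeTwist_symm]
    exact SubproductSystem.continuous_gaugeTwist h2 h1 v u
  · rintro ⟨φ, h1⟩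
    obtain ⟨u, v, h⟩ := SubproductSystem.exists_vacuumPreserving_gaugeTwist φ
    exact ⟨_, SubproductSystem.isometry_gaugeTwist h1 u v, h⟩
  · rintro ⟨φ, h1, h2⟩
    obtain ⟨u, v, h⟩ := SubproductSystem.exists_vacuumPreserving_gaugeTwist φ
    refine ⟨_, SubproductSystem.isCompletelyBounded_gaugeTwist h1 h2 u v, ?_, h⟩
    rw [SubproductSystem.gaugeTwist_symm]
    exact SubproductSystem.isCompletelyBounded_gaugeTwist h2 h1 v u
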